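/- Let $\mathcal F$ be a proper filter on $\omega$, and suppose that there is an injective sequence $(x_n)_{n\in\omega}$ in $\beta\omega$ (the Stone–Čech compactification of the discrete space $\omega$) that $\mathcal F$-converges to some point $x_\infty\in\beta\omega$, that is, $\{n\in\omega: x_n\in O\}\in\mathcal F$ for every neighborhood $O$ of $x_\infty$. Put $\mathcal F^+=\{A\subseteq\omega: A\cap F\neq\emptyset\text{ for all }F\in\mathcal F\}$. Call $\mathcal F$ a $P^+$-filter if for every countable $\mathcal C\subseteq\mathcal F$ there is an infinite set $A\in\mathcal F^+$ such that $A\setminus C$ is finite for all $C\in\mathcal C$. The character $\chi(\mathcal F)$ is the smallest cardinality of a family $\mathcal B\subseteq\mathcal F$ such that $\mathcal F=\{F\subseteq\omega:\exists B\in\mathcal B\ (B\subseteq F)\}$. Let $\mathfrak d$ be the smallest cardinality of a cofinal subset of $(\omega^\omega,\le)$ with the pointwise order, and $\mathfrak u$ the smallest character of a nonprincipal ultrafilter on $\omega$. A filter is called analytic (respectively, $F_\sigma$) if it is an analytic (respectively, $F_\sigma$) subset of $\mathcal P(\omega)=2^\omega$ with the product topology. Then: 1. If $\mathcal F$ is a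 $P^+$-filter, then for some $A\in\mathcal F^+$ the filter $\mathcal F|A=\{F\cap A:F\in\mathcal F\}$ on $A$ is an ultrafilter. If, moreover, $\mathcal F$ is free (that is, $\mathcal F$ contains all cofinite subsets of $\omega$), then: 2. $\chi(\mathcal F)\ge\min\{\mathfrak d,\mathfrak u\}$; 3. $\mathcal F$ is not an analytic $P^+$-filter, i.e. $\mathcal F$ is not both analytic and a $P^+$-filter; 4. $\mathcal F$ is not an $F_\sigma$-filter. -/

import Mathlib

open Filter Topology Cardinal

namespace FilterConv

/-- The family `F⁺` of all sets that meet every member of `F`. -/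
def positiveSets (F : Filter ℕ) : Set (Set ℕ) :=
  {A | ∀ S ∈ F, (A ∩ S).Nonempty}

/-- A pseudointersection of the family `C`: an infinite set `A` such that `A \ S` is finite
for every `S ∈ C`. -/
def IsPseudointersection (A : Set ℕ) (C : Set (Set ℕ)) : Prop :=
  A.Infinite ∧ ∀ S ∈ C, (A \ S).Finite

/-- `F` is a `P⁺`-filter: every countable subfamily of `F` has a pseudointersection
that belongs to `F⁺`. -/
def IsPPlus (F : Filter ℕ) : Prop :=
  ∀ C : Set (Set ℕ), C ⊆ F.sets → C.Countable →
    ∃ A ∈ positiveSets F, IsPseudointersection A C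

/-- The trace `F|A = {S ∩ A : S ∈ F}`, as a filter on the subtype `A`. -/
def restrict (F : Filter ℕ) (A : Set ℕ) : Filter A :=
  F.comap Subtype.val

theorem mem_restrict_iff (F : Filter ℕ) (A : Set ℕ) (T : Set A) :
    T ∈ restrict F A ↔ ∃ S ∈ F, Subtype.val '' T = S ∩ A := by
  constructor
  · rintro ⟨S, hS, hST⟩
    refine ⟨S ∪ Subtype.val '' T, mem_of_superset hS Set.subset_union_left, ?_⟩
    ext n
    constructor
    · rintro ⟨a, ha, rfl⟩
      exact ⟨Or.inr ⟨a, ha, rfl⟩, a.2⟩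
    · rintro ⟨h | h, hA⟩
      · exact ⟨⟨n, hA⟩, hST h, rfl⟩
      · exact h
  · rintro ⟨S, hS, h⟩
    refine ⟨S, hS, fun a ha => ?_⟩
    have h1 : (a : ℕ) ∈ Subtype.val '' T := by
      rw [h]
      exact ⟨ha, a.2⟩
    obtain ⟨b, hb, hab⟩ := h1
    rwa [← Subtype.ext hab]

/-- A filter is an ultrafilter. -/
def IsUltra {α : Type} (G : Filter α) : Prop :=
  ∃ U : Ultrafilter α, (U : Filter α) = G

/-- The character of a filter: the least cardinality of a family `B ⊆ F` with
`F = {S : ∃ b ∈ B, b ⊆ S}`. -/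
noncomputable def character (F : Filter ℕ) : Cardinal.{0} :=
  sInf {κ | ∃ B : Set (Set ℕ), B ⊆ F.sets ∧ F.sets = {S | ∃ b ∈ B, b ⊆ S} ∧ #B = κ}

/-- The dominating number `𝔡`: the least cardinality of a cofinal subset of `ℕ → ℕ` with the
pointwise order. -/
noncomputable def dominatingNumber : Cardinal.{0} :=
  Order.cof (ℕ → ℕ)

/-- The ultrafilter number `𝔲`: the least character of a nonprincipal ultrafilter on `ℕ`. -/
noncomputable def ultrafilterNumber : Cardinal.{0} :=
  sInf {κ | ∃ U : Ultrafilter ℕ, (∀ n : ℕ, U ≠ pure n) ∧ character (U : Filter ℕ) = κ}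

/-- The filter `F` as a subset of the Cantor cube `2^ω`, a set of natural numbers being
identified with its characteristic function. -/
def toCube (F : Filter ℕ) : Set (ℕ → Bool) :=
  {f | {n | f n = true} ∈ F}

/-- `F` is an analytic subset of the Cantor cube. -/
def IsAnalytic (F : Filter ℕ) : Prop :=
  MeasureTheory.AnalyticSet (toCube F)

/-- `F` is an `F_σ` subset of the Cantor cube. -/
def IsFSigma (F : Filter ℕ) : Prop :=
  ∃ C : ℕ → Set (ℕ → Bool), (∀ i, IsClosed (C i)) ∧ toCube F = ⋃ i, C i

/-- The space `βω` is `Ultrafilter ℕ`, with the topology generated by the sets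
`{u | S ∈ u}`. The filter `F` admits an injective `F`-convergent sequence in `βω`. -/
def AdmitsInjectiveSeq (F : Filter ℕ) : Prop :=
  ∃ x : ℕ → Ultrafilter ℕ, Function.Injective x ∧ ∃ p : Ultrafilter ℕ, Tendsto x F (𝓝 p)

end FilterConv

/-! For `U n ∈ p` with `U n ∉ x n`, convergence puts every `{m | U n ∈ x m}` in `F`. A positive
pseudointersection `A` of these sets makes the points `x m ≠ p`, `m ∈ A`, a discrete family. Every
`T ⊆ A` is then cut out by a single `V ⊆ ω`, and whichever of `V`, `Vᶜ` lies in `p` decides `T` in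
the trace (`exists_isUltra_restrict`). A free filter that is `F_σ` or has character below `𝔡` is
`P⁺`. Its ultrafilter trace, moved to `ω` along an injection, is free and inherits analyticity and a
character no larger than that of `F`; but a free ultrafilter is never analytic. -/

namespace FilterConv

open Set

/-! ### Ultrafilter traces from discrete sequences -/

section Trace

variable {F : Filter ℕ} {A : Set ℕ}

theorem isUltra_restrict (hA : A ∈ positiveSets F)
    (h : ∀ T : Set A, T ∈ restrict F A ∨ Tᶜ ∈ restrict F A) : IsUltra (restrict F A) := by
  have hne : (restrict F A).NeBot := by
    refine comap_neBot_iff.2 fun S hS => ?_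
    obtain ⟨a, ha, haS⟩ := hA S hS
    exact ⟨⟨a, ha⟩, haS⟩
  refine ⟨Ultrafilter.ofComplNotMemIff (restrict F A) fun T => ?_, rfl⟩
  exact ⟨fun hT => (h T).resolve_right hT, fun hT hT' => compl_notMem hT hT'⟩

/-- Countably many ultrafilters forming a discrete subspace are separated by disjoint sets, so
every set of indices is cut out by a single set. -/
theorem exists_mem_iff_of_discrete {α : Type*} {x : ℕ → Ultrafilter α} {D : Set ℕ}
    (h : ∀ m ∈ D, ∃ W ∈ x m, ∀ k ∈ D, k ≠ m → W ∉ x k) (B : Set ℕ) :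
    ∃ V : Set α, ∀ m ∈ D, (V ∈ x m ↔ m ∈ B) := by
  choose! W hW hWk using h
  set V : ℕ → Set α := fun m => W m ∩ ⋂ k ∈ {k | k < m ∧ k ∈ D}, (W k)ᶜ with hV
  have hfin (m : ℕ) : {k | k < m ∧ k ∈ D}.Finite := (finite_lt_nat m).subset fun k hk => hk.1
  have hVm : ∀ m ∈ D, V m ∈ x m := fun m hm =>
    inter_mem (hW m hm) <| (biInter_mem (hfin m)).2 fun k hk =>
      Ultrafilter.compl_mem_iff_notMem.2 (hWk k hk.2 m hm hk.1.ne')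
  have hlt : ∀ m ∈ D, ∀ k ∈ D, k < m → Disjoint (V k) (V m) := fun m hm k hk hkm =>
    disjoint_left.2 fun a hak ham => mem_iInter₂.1 ham.2 k ⟨hkm, hk⟩ hak.1
  have hdisj : ∀ m ∈ D, ∀ k ∈ D, k ≠ m → Disjoint (V k) (V m) := fun m hm k hk hkm =>
    hkm.lt_or_gt.elim (hlt m hm k hk) fun h => (hlt k hk m hm h).symm
  refine ⟨⋃ k ∈ B ∩ D, V k, fun m hm => ⟨fun hU => ?_, fun hB => ?_⟩⟩
  · by_contra hB
    obtain ⟨a, ha, ham⟩ := (x m).nonempty_of_mem (inter_mem hU (hVm m hm))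
    obtain ⟨k, hk, hak⟩ := mem_iUnion₂.1 ha
    exact disjoint_left.1 (hdisj m hm k hk.2 fun e => hB (e ▸ hk.1)) hak ham
  · exact mem_of_superset (hVm m hm) (subset_biUnion_of_mem (u := V) ⟨hB, hm⟩)

theorem isUltra_restrict_of_discrete {x : ℕ → Ultrafilter ℕ} {p : Ultrafilter ℕ}
    (hp : Tendsto x F (𝓝 p)) (hA : A ∈ positiveSets F)
    (h : ∀ m ∈ A, ∃ W ∈ x m, ∀ k ∈ A, k ≠ m → W ∉ x k) : IsUltra (restrict F A) := by
  have key : ∀ (T : Set A) (V : Set ℕ), (∀ m ∈ A, (V ∈ x m → m ∈ Subtype.val '' T)) → V ∈ p →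
      T ∈ restrict F A := by
    intro T V hV hVp
    refine ⟨{m | V ∈ x m}, hp ((ultrafilter_isOpen_basic V).mem_nhds hVp), fun a ha => ?_⟩
    obtain ⟨b, hb, hab⟩ := hV a a.2 ha
    rwa [← Subtype.ext hab]
  refine isUltra_restrict hA fun T => ?_
  obtain ⟨V, hV⟩ := exists_mem_iff_of_discrete h (Subtype.val '' T)
  refine (em (V ∈ p)).imp (key T V fun m hm => (hV m hm).1) fun hVp =>
    key Tᶜ Vᶜ (fun m hm hVm => ⟨⟨m, hm⟩, fun hT => ?_, rfl⟩)
      (Ultrafilter.compl_mem_iff_notMem.2 hVp)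
  exact Ultrafilter.compl_mem_iff_notMem.1 hVm ((hV m hm).2 ⟨_, hT, rfl⟩)

theorem exists_isUltra_restrict (hF : AdmitsInjectiveSeq F) (hP : IsPPlus F) :
    ∃ A ∈ positiveSets F, IsUltra (restrict F A) := by
  obtain ⟨x, hx, p, hp⟩ := hF
  have hsep : ∀ u v : Ultrafilter ℕ, u ≠ v → ∃ U ∈ u, U ∉ v := by
    intro u v huv
    by_contra! h
    exact huv (Ultrafilter.coe_le_coe.1 fun s hs => by_contra fun hsu =>
      Ultrafilter.compl_mem_iff_notMem.1 (h _ (Ultrafilter.compl_mem_iff_notMem.2 hsu)) hs)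
  have hU : ∀ n, ∃ U ∈ p, x n ≠ p → U ∉ x n := fun n => by
    by_cases hn : x n = p
    · exact ⟨univ, univ_mem, fun h => (h hn).elim⟩
    · obtain ⟨U, hU, hUn⟩ := hsep p (x n) (Ne.symm hn)
      exact ⟨U, hU, fun _ => hUn⟩
  choose U hUp hUx using hU
  obtain ⟨A, hA, -, hAfin⟩ := hP (range fun n => {m | U n ∈ x m})
    (range_subset_iff.2 fun n => hp ((ultrafilter_isOpen_basic (U n)).mem_nhds (hUp n)))
    (countable_range _)
  -- By injectivity at most one index has `x m = p`. If removing it destroys positivity, the trace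
  -- on `A` is principal at that index.
  by_cases hD : A \ {m | x m = p} ∈ positiveSets F
  · refine ⟨_, hD, isUltra_restrict_of_discrete hp hD fun m hm => ?_⟩
    have hT : ∀ k, ∃ T ∈ x m, k ≠ m → T ∉ x k := fun k => by
      by_cases hk : k = m
      · exact ⟨univ, univ_mem, fun h => (h hk).elim⟩
      · obtain ⟨T, hT, hTk⟩ := hsep (x m) (x k) fun h => hk (hx h).symm
        exact ⟨T, hT, fun _ => hTk⟩
    choose T hTm hTk using hT
    refine ⟨(U m)ᶜ ∩ ⋂ k ∈ A \ {k | U m ∈ x k}, T k,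
      inter_mem (Ultrafilter.compl_mem_iff_notMem.2 (hUx m hm.2))
        ((biInter_mem (hAfin _ ⟨m, rfl⟩)).2 fun k _ => hTm k), fun k hk hkm hW => ?_⟩
    have hk' : k ∈ A \ {k | U m ∈ x k} :=
      ⟨hk.1, Ultrafilter.compl_mem_iff_notMem.1 (mem_of_superset hW inter_subset_left)⟩
    exact hTk k hkm (mem_of_superset hW (inter_subset_right.trans (biInter_subset_of_mem hk')))
  · obtain ⟨S, hS, hSD⟩ : ∃ S ∈ F, ¬ ((A \ {m | x m = p}) ∩ S).Nonempty := by
      simpa [positiveSets] using hD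
    have hSp : ∀ m ∈ A, m ∈ S → x m = p := fun m hm hmS =>
      by_contra fun h => hSD ⟨m, ⟨hm, h⟩, hmS⟩
    obtain ⟨a, ha, haS⟩ := hA S hS
    have key : ∀ T : Set A, ⟨a, ha⟩ ∈ T → T ∈ restrict F A := fun T hT =>
      ⟨S, hS, fun b hb => by
        have : b = ⟨a, ha⟩ := Subtype.ext (hx ((hSp b b.2 hb).trans (hSp a ha haS).symm))
        rwa [this]⟩
    exact ⟨A, hA, isUltra_restrict hA fun T => (em _).imp (key T) (key Tᶜ)⟩

theorem infinite_of_mem_positiveSets (hF : F ≤ cofinite) (hA : A ∈ positiveSets F) :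
    A.Infinite := fun h => by
  obtain ⟨a, ha, ha'⟩ := hA Aᶜ (hF h.compl_mem_cofinite)
  exact ha' ha

/-- An ultrafilter trace of a free filter, transported to `ℕ`. -/
theorem exists_ultrafilter_eq_comap (hF : F ≤ cofinite) (hA : A ∈ positiveSets F)
    (h : IsUltra (restrict F A)) :
    ∃ e : ℕ → ℕ, e.Injective ∧ ∃ U : Ultrafilter ℕ,
      (U : Filter ℕ) = F.comap e ∧ (U : Filter ℕ) ≤ cofinite := by
  have := (infinite_of_mem_positiveSets hF hA).to_subtype
  obtain ⟨φ⟩ : Nonempty (ℕ ≃ A) := nonempty_equiv_of_countable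
  obtain ⟨V, hV⟩ := h
  have hinj : (Subtype.val ∘ φ : ℕ → ℕ).Injective := Subtype.val_injective.comp φ.injective
  have hcomap : (V.map φ.symm : Filter ℕ) = F.comap (Subtype.val ∘ φ) := by
    rw [Ultrafilter.coe_map, hV, restrict, ← comap_comap, ← comap_equiv_symm φ.symm]
    rfl
  refine ⟨_, hinj, V.map φ.symm, hcomap, ?_⟩
  rw [hcomap]
  exact (comap_mono hF).trans (hinj.comap_cofinite_eq.le)

end Trace

/-! ### Sufficient conditions for `P⁺`, and characters -/

section PPlus

variable {F : Filter ℕ}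

/-- The union of the `a n` is the pseudointersection: only the finitely many `a k` with `k < n` can
leave the `n`-th set. -/
theorem isPPlus_of_finite_hitting (hF : F ≤ cofinite)
    (h : ∀ S : ℕ → Set ℕ, Antitone S → (∀ n, S n ∈ F) →
      ∃ a : ℕ → Set ℕ, (∀ n, (a n).Finite ∧ a n ⊆ S n) ∧ ∀ T ∈ F, ∃ n, (a n ∩ T).Nonempty) :
    IsPPlus F := by
  intro C hCF hC
  obtain ⟨f, hf⟩ := (hC.insert Set.univ).exists_eq_range (insert_nonempty _ _)
  have hfF : ∀ n, f n ∈ F := fun n => by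
    have : f n ∈ insert Set.univ C := hf ▸ mem_range_self n
    exact this.elim (fun e => e ▸ univ_mem) fun hn => hCF hn
  obtain ⟨a, ha, hhit⟩ := h (fun n => ⋂ k ∈ {k | k ≤ n}, f k)
    (fun m n hmn => biInter_subset_biInter_left fun k (hk : k ≤ m) => hk.trans hmn)
    (fun n => (biInter_mem (finite_le_nat n)).2 fun k _ => hfF k)
  have hpos : (⋃ n, a n) ∈ positiveSets F := fun T hT => by
    obtain ⟨n, k, hk, hkT⟩ := hhit T hT
    exact ⟨k, mem_iUnion.2 ⟨n, hk⟩, hkT⟩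
  refine ⟨_, hpos, infinite_of_mem_positiveSets hF hpos, fun S hS => ?_⟩
  obtain ⟨n, rfl⟩ : S ∈ range f := hf ▸ mem_insert_of_mem _ hS
  refine ((finite_lt_nat n).biUnion fun k _ => (ha k).1).subset fun m hm => ?_
  obtain ⟨k, hk⟩ := mem_iUnion.1 hm.1
  refine mem_biUnion (show k < n from lt_of_not_ge fun hnk => hm.2 ?_) hk
  exact mem_iInter₂.1 ((ha k).2 hk) n hnk

/-- Compactness: every member of `C n` meets `S n`, so one finite part of `S n` meets them all. -/
theorem isPPlus_of_isFSigma [F.NeBot] (hF : F ≤ cofinite) (h : IsFSigma F) : IsPPlus F := by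
  obtain ⟨C, hC, hCF⟩ := h
  refine isPPlus_of_finite_hitting hF fun S _ hS => ?_
  have hex : ∀ n, ∃ a ⊆ S n, a.Finite ∧ C n ⊆ ⋃ k ∈ a, {f : ℕ → Bool | f k = true} := fun n => by
    refine (hC n).isCompact.elim_finite_subcover_image
      (fun k _ => (isOpen_discrete ({true} : Set Bool)).preimage
        (continuous_apply (A := fun _ : ℕ => Bool) k)) fun f hf => ?_
    have hfF : f ∈ toCube F := hCF ▸ mem_iUnion.2 ⟨n, hf⟩
    obtain ⟨k, hk, hkS⟩ := Filter.nonempty_of_mem (inter_mem hfF (hS n))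
    exact mem_biUnion hkS hk
  choose a haS hafin haC using hex
  refine ⟨a, fun n => ⟨hafin n, haS n⟩, fun T hT => ?_⟩
  classical
  have hmem : (fun k => decide (k ∈ T)) ∈ toCube F := by simpa [toCube] using hT
  rw [hCF] at hmem
  obtain ⟨n, hn⟩ := mem_iUnion.1 hmem
  obtain ⟨k, hk, hkT⟩ := mem_iUnion₂.1 (haC n hn)
  exact ⟨n, k, hk, of_decide_eq_true hkT⟩

theorem exists_base_card_eq_character (F : Filter ℕ) :
    ∃ B : Set (Set ℕ), B ⊆ F.sets ∧ F.sets = {S | ∃ b ∈ B, b ⊆ S} ∧ #B = character F := by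
  refine csInf_mem (s := {κ | ∃ B : Set (Set ℕ), B ⊆ F.sets ∧
    F.sets = {S | ∃ b ∈ B, b ⊆ S} ∧ #B = κ}) ⟨_, F.sets, Subset.rfl, ?_, rfl⟩
  ext S
  exact ⟨fun h => ⟨S, h, Subset.rfl⟩, fun ⟨b, hb, hbS⟩ => mem_of_superset hb hbS⟩

theorem isPPlus_of_character_lt [F.NeBot] (hF : F ≤ cofinite)
    (h : character F < dominatingNumber) : IsPPlus F := by
  obtain ⟨B, hBF, hB, hcard⟩ := exists_base_card_eq_character F
  refine isPPlus_of_finite_hitting hF fun S _ hS => ?_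
  have hex : ∀ b : B, ∀ n, ∃ k, k ∈ b.1 ∩ S n := fun b n =>
    Filter.nonempty_of_mem (inter_mem (hBF b.2) (hS n))
  choose f hf using hex
  have hcof : ¬ IsCofinal (range f) := fun hc =>
    ((Order.cof_le hc).trans (mk_range_le.trans hcard.le)).not_gt h
  -- Fewer than `𝔡` functions `f b` leave some `g` undominated; cutting `S n` at `g n` then catches
  -- a point of each `b`.
  obtain ⟨g, hg⟩ : ∃ g, ∀ b, ¬ g ≤ f b := by simpa [IsCofinal] using hcof
  refine ⟨fun n => S n ∩ {k | k ≤ g n}, fun n => ⟨(finite_le_nat _).inter_of_right _,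
    inter_subset_left⟩, fun T hT => ?_⟩
  obtain ⟨b, hb, hbT⟩ : T ∈ {S | ∃ b ∈ B, b ⊆ S} := hB ▸ hT
  obtain ⟨n, hn⟩ := not_forall.1 (hg ⟨b, hb⟩)
  exact ⟨n, f ⟨b, hb⟩ n, ⟨(hf ⟨b, hb⟩ n).2, (lt_of_not_ge hn).le⟩, hbT (hf ⟨b, hb⟩ n).1⟩

theorem character_comap_le (F : Filter ℕ) (e : ℕ → ℕ) :
    character (F.comap e) ≤ character F := by
  obtain ⟨B, hBF, hB, hcard⟩ := exists_base_card_eq_character F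
  suffices h : preimage e '' B ⊆ (F.comap e).sets ∧
      (F.comap e).sets = {S | ∃ b ∈ preimage e '' B, b ⊆ S} from
    (csInf_le' ⟨_, h.1, h.2, rfl⟩ : character (F.comap e) ≤ #(preimage e '' B)).trans
      (mk_image_le.trans hcard.le)
  constructor
  · rintro _ ⟨b, hb, rfl⟩
    exact preimage_mem_comap (hBF hb)
  · ext T
    constructor
    · rintro ⟨S, hS, hST⟩
      obtain ⟨b, hb, hbS⟩ : S ∈ {S | ∃ b ∈ B, b ⊆ S} := hB ▸ hS
      exact ⟨_, ⟨b, hb, rfl⟩, (preimage_mono hbS).trans hST⟩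
    · rintro ⟨_, ⟨b, hb, rfl⟩, hbT⟩
      exact ⟨b, hBF hb, hbT⟩

theorem ultrafilterNumber_le_character {U : Ultrafilter ℕ} (hU : (U : Filter ℕ) ≤ cofinite) :
    ultrafilterNumber ≤ character (U : Filter ℕ) := by
  refine csInf_le' ⟨U, fun n hn => ?_, rfl⟩
  have : ({n}ᶜ : Set ℕ) ∈ U := hU (finite_singleton n).compl_mem_cofinite
  rw [hn] at this
  exact Ultrafilter.mem_pure.1 this rfl

end PPlus

/-! ### Free ultrafilters are not analytic -/

section Analytic

instance polishSpace_cantor : PolishSpace (ℕ → Bool) where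
  toSecondCountableTopology := inferInstance
  toIsCompletelyMetrizableSpace := by
    let := TopologicalSpace.metrizableSpaceMetric (ℕ → Bool)
    infer_instance

/-- Negation of all coordinates outside the finite set `I`. -/
def flipOutside (I : Finset ℕ) (f : ℕ → Bool) : ℕ → Bool :=
  fun n => if n ∈ I then f n else !f n

theorem flipOutside_involutive (I : Finset ℕ) : (flipOutside I).Involutive := fun f => by
  ext n
  by_cases h : n ∈ I <;> simp [flipOutside, h]

theorem continuous_flipOutside (I : Finset ℕ) : Continuous (flipOutside I) := by
  refine continuous_pi fun n => ?_
  by_cases h : n ∈ I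
  · simpa [flipOutside, h] using continuous_apply n
  · simpa [flipOutside, h, Function.comp_def] using (continuous_of_discreteTopology (f := not)).comp
      (continuous_apply (A := fun _ : ℕ => Bool) n)

theorem tendsto_flipOutside_residual (I : Finset ℕ) :
    Tendsto (flipOutside I) (residual (ℕ → Bool)) (residual (ℕ → Bool)) :=
  tendsto_residual_of_isOpenMap (continuous_flipOutside I)
    (Homeomorph.mk (flipOutside_involutive I).toPerm (continuous_flipOutside I)
      (continuous_flipOutside I)).isOpenMap

theorem flipOutside_mem_toCube_iff {U : Ultrafilter ℕ} (hU : (U : Filter ℕ) ≤ cofinite)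
    (I : Finset ℕ) (f : ℕ → Bool) : flipOutside I f ∈ toCube U ↔ f ∉ toCube U := by
  have hI : ((I : Set ℕ)ᶜ) ∈ (U : Filter ℕ) := hU I.finite_toSet.compl_mem_cofinite
  have : {n | flipOutside I f n = true} ∈ (U : Filter ℕ) ↔ {n | f n = true}ᶜ ∈ (U : Filter ℕ) := by
    refine congr_sets (mem_of_superset hI fun n (hn : n ∉ (I : Set ℕ)) => ?_)
    have hn' : n ∉ I := hn
    simp [flipOutside, hn']
  exact this.trans Ultrafilter.compl_mem_iff_notMem

/-- Flipping all coordinates swaps `U` with its complement, so an analytic `U` would be Borel by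
Suslin, hence equal to an open `V` modulo a meagre set. Each `flipOutside I` swaps them too, yet
preserves cylinders over `I`. -/
theorem not_isAnalytic_ultrafilter {U : Ultrafilter ℕ} (hU : (U : Filter ℕ) ≤ cofinite) :
    ¬ IsAnalytic (U : Filter ℕ) := by
  intro h
  have hcompl : (toCube (U : Filter ℕ))ᶜ = flipOutside ∅ ⁻¹' toCube (U : Filter ℕ) :=
    ext fun f => (flipOutside_mem_toCube_iff hU ∅ f).symm
  have hmeas : MeasurableSet (toCube (U : Filter ℕ)) :=
    MeasureTheory.AnalyticSet.measurableSet_of_compl h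
      (hcompl ▸ h.preimage (continuous_flipOutside ∅))
  obtain ⟨V, hVo, hV⟩ := hmeas.residualEq_isOpen
  have key : ∀ I : Finset ℕ, ∀ᶠ f in residual (ℕ → Bool), ¬ (f ∈ V ↔ flipOutside I f ∈ V) := by
    intro I
    filter_upwards [hV.mem_iff, (tendsto_flipOutside_residual I).eventually hV.mem_iff]
      with f h1 h2
    rw [← h1, ← h2, flipOutside_mem_toCube_iff hU]
    tauto
  have hnon : ∀ W : Set (ℕ → Bool), IsOpen W → W.Nonempty → ∀ I : Finset ℕ,
      ∃ f ∈ W, ¬ (f ∈ V ↔ flipOutside I f ∈ V) := by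
    intro W hW hne I
    obtain ⟨f, hfW, hf⟩ := (dense_of_mem_residual (key I)).inter_open_nonempty W hW hne
    exact ⟨f, hfW, hf⟩
  rcases V.eq_empty_or_nonempty with rfl | ⟨f, hf⟩
  · obtain ⟨f, -, hf⟩ := hnon univ isOpen_univ univ_nonempty ∅
    simp at hf
  · obtain ⟨I, u, hu, huV⟩ := isOpen_pi_iff.1 hVo f hf
    obtain ⟨g, hg, hgV⟩ := hnon ((I : Set ℕ).pi u)
      (isOpen_set_pi I.finite_toSet fun n hn => (hu n hn).1) ⟨f, fun n hn => (hu n hn).2⟩ I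
    refine hgV ⟨fun _ => huV fun n hn => ?_, fun _ => huV hg⟩
    have hn' : n ∈ I := hn
    simpa [flipOutside, hn'] using hg n hn

theorem isAnalytic_comap {F : Filter ℕ} (hF : IsAnalytic F) {e : ℕ → ℕ} (he : e.Injective) :
    IsAnalytic (F.comap e) := by
  -- The default `true` off the range of `e` yields the largest set whose preimage under `e` is the
  -- given one.
  have hcont : Continuous fun f : ℕ → Bool => Function.extend e f fun _ => true := by
    refine continuous_pi fun y => ?_
    by_cases hy : ∃ x, e x = y
    · obtain ⟨x, rfl⟩ := hy
      simpa [he.extend_apply] using continuous_apply x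
    · simpa [Function.extend_apply' _ _ _ hy] using continuous_const
  have hpre : toCube (F.comap e) =
      (fun f : ℕ → Bool => Function.extend e f fun _ => true) ⁻¹' toCube F := by
    ext f
    refine mem_comap'.trans (iff_of_eq (congrArg (· ∈ F) (ext fun y => ?_)))
    by_cases hy : ∃ x, e x = y
    · obtain ⟨x, rfl⟩ := hy
      simp [he.extend_apply, he.eq_iff]
    · simpa [Function.extend_apply' _ _ _ hy] using fun x hx => (hy ⟨x, hx⟩).elim
  rw [IsAnalytic, hpre]
  exact MeasureTheory.AnalyticSet.preimage hF hcont

theorem isAnalytic_of_isFSigma {F : Filter ℕ} (h : IsFSigma F) : IsAnalytic F := by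
  obtain ⟨C, hC, hCF⟩ := h
  rw [IsAnalytic, hCF]
  exact MeasureTheory.AnalyticSet.iUnion fun n => (hC n).analyticSet

end Analytic

end FilterConv

theorem mainTheorem7 (F : Filter ℕ) [F.NeBot] (hF : FilterConv.AdmitsInjectiveSeq F) :
    (FilterConv.IsPPlus F →
      ∃ A ∈ FilterConv.positiveSets F, FilterConv.IsUltra (FilterConv.restrict F A)) ∧
    (F ≤ Filter.cofinite →
      min FilterConv.dominatingNumber FilterConv.ultrafilterNumber ≤ FilterConv.character F ∧
      ¬ (FilterConv.IsAnalytic F ∧ FilterConv.IsPPlus F) ∧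
      ¬ FilterConv.IsFSigma F) := by
  refine ⟨FilterConv.exists_isUltra_restrict hF, fun hfree => ?_⟩
  have hultra : FilterConv.IsPPlus F → ∃ e : ℕ → ℕ, e.Injective ∧ ∃ U : Ultrafilter ℕ,
      (U : Filter ℕ) = F.comap e ∧ (U : Filter ℕ) ≤ cofinite := fun hP => by
    obtain ⟨A, hA, hAU⟩ := FilterConv.exists_isUltra_restrict hF hP
    exact FilterConv.exists_ultrafilter_eq_comap hfree hA hAU
  have hanalytic : ¬ (FilterConv.IsAnalytic F ∧ FilterConv.IsPPlus F) := by
    rintro ⟨hFa, hP⟩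
    obtain ⟨e, he, U, hU, hUfree⟩ := hultra hP
    exact FilterConv.not_isAnalytic_ultrafilter hUfree (hU ▸ FilterConv.isAnalytic_comap hFa he)
  refine ⟨?_, hanalytic, fun h => hanalytic
    ⟨FilterConv.isAnalytic_of_isFSigma h, FilterConv.isPPlus_of_isFSigma hfree h⟩⟩
  rcases le_or_gt FilterConv.dominatingNumber (FilterConv.character F) with h | h
  · exact (min_le_left _ _).trans h
  · obtain ⟨e, -, U, hU, hUfree⟩ := hultra (FilterConv.isPPlus_of_character_lt hfree h)
    exact (min_le_right _ _).trans ((FilterConv.ultrafilterNumber_le_character hUfree).trans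
      (hU ▸ FilterConv.character_comap_le F e))
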